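/- Let $\mathbb T=\mathbb R/\mathbb Z$, let $\alpha>0$, $\beta>1$ and $T>0$, and let $k=k(n)\in\mathbb N$ satisfy $k(n)\to\infty$ as $n\to\infty$, with no restriction on the growth of $k$. Let $\gamma:\mathbb T\to[0,1]$ be smooth and suppose there is $\varepsilon_0\in(0,1/2)$ with $\varepsilon_0<\gamma(u)<1-\varepsilon_0$ for all $u\in\mathbb T$. Let $\mathbb T_{nk}=\mathbb Z/nk\mathbb Z=\{0,\dots,nk-1\}$ and $\Omega_{nk}=\{0,1\}^{\mathbb T_{nk}}$. For $f:\Omega_{nk}\to\mathbb R$ put $$(\mathcal L_nf)(\eta)=\sum_{x\in\mathbb T_{nk}}\xi^{nk}_{x,x+1}\,[f(\eta^{x,x+1})-f(\eta)],$$ where $\eta^{x,x+1}$ is obtained from $\eta$ by exchanging $\eta(x)$ and $\eta(x+1)$, and $\xi^{nk}_{x,x+1}=\alpha n^{-\beta}$ if $x=jn-1$ for some $j\in\{1,\dots,k\}$, $\xi^{nk}_{x,x+1}=1$ otherwise. Let $(\eta^n_t)_{t\ge0}$ be the Markov process on $\Omega_{nk}$ with generator $k^2n^{1+\beta}\mathcal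 L_n$, started from the Bernoulli product measure $\mu^n$ with $\mu^n\{\eta(x)=1\}=\gamma(x/kn)$ for $x\in\mathbb T_{nk}$, and let $$\pi^n_t=\frac1k\sum_{i=0}^{k-1}\Big(\frac1n\sum_{x=in}^{(i+1)n-1}\eta^n_t(x)\Big)\delta_{i/k}.$$ Let $\rho$ be the strong solution (of class $C^{1,2}$ on $[0,T]\times\mathbb T$) of the heat equation $\partial_t\rho_t(u)=\alpha\Delta\rho_t(u)$ on $\mathbb T$ with $\rho_0=\gamma$. Then, for every $t\in[0,T]$ and every $G\in C^2(\mathbb T)$, $$\lim_{n\to\infty}\mathbb E_{\mu^n}\Big[\Big|\langle\pi^n_t,G\rangle-\int_{\mathbb T}G(u)\rho_t(u)\,du\Big|\Big]=0.$$ -/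

import Mathlib

open MeasureTheory ProbabilityTheory Filter Topology Set
open scoped NNReal ContDiff

noncomputable section

namespace SlowBondExclusion

/-- The continuous torus `𝕋 = ℝ / ℤ`; its `volume` is Lebesgue measure of total mass one. -/
abbrev Torus : Type := UnitAddCircle

/-- A real function on the torus is of class `C^m` if its `1`-periodic lift to `ℝ` is. -/
def TorusContDiff (m : WithTop ℕ∞) (g : Torus → ℝ) : Prop :=
  ContDiff ℝ m (fun u : ℝ => g (u : Torus))

/-! ### The exclusion process with slow bonds on the discrete torus with `k * n` sites -/

/-- The sites `0, …, k n - 1` of the discrete torus, arranged in `k` boxes of `n` sites. -/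
abbrev Site (n k : ℕ) : Type := Fin (k * n)

/-- The site `x + 1`, modulo `k n`. -/
def next (n k : ℕ) (x : Site n k) : Site n k := finRotate (k * n) x

/-- Configurations in `{0,1}^(sites)`; `true` means that the site is occupied. -/
abbrev Config (n k : ℕ) : Type := Site n k → Bool

/-- The occupation variable `η(x) ∈ {0, 1}` as a real number. -/
def occ {n k : ℕ} (η : Config n k) (x : Site n k) : ℝ := if η x then 1 else 0

/-- The configuration `η^{x,x+1}`, where the values at `x` and `x + 1` are exchanged. -/
def exchange {n k : ℕ} (η : Config n k) (x : Site n k) : Config n k :=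
  fun y => η (Equiv.swap x (next n k x) y)

/-- The conductance of the bond `{x, x + 1}`: it is `α n^(-β)` if `x = j n - 1` for some
`j ∈ {1, …, k}`, and `1` otherwise. -/
def conductance (α β : ℝ) (n k : ℕ) (x : Site n k) : ℝ :=
  if n ∣ (x : ℕ) + 1 then α * (n : ℝ) ^ (-β) else 1

/-- The generator of the exclusion process with slow bonds (not speeded up):
`(L f)(η) = ∑ₓ ξ_{x,x+1} (f(η^{x,x+1}) - f(η))`. -/
def generator (α β : ℝ) (n k : ℕ) : (Config n k → ℝ) →L[ℝ] (Config n k → ℝ) :=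
  LinearMap.toContinuousLinearMap
    { toFun := fun f η => ∑ x : Site n k, conductance α β n k x * (f (exchange η x) - f η)
      map_add' := fun f g => by
        funext η
        simp only [Pi.add_apply, ← Finset.sum_add_distrib]
        exact Finset.sum_congr rfl fun x _ => by ring
      map_smul' := fun c f => by
        funext η
        simp only [Pi.smul_apply, smul_eq_mul, RingHom.id_apply, Finset.mul_sum]
        exact Finset.sum_congr rfl fun x _ => by ring }

/-- The Bernoulli product measure associated to the profile `γ`: the occupation variables are
independent, and the site `x` is occupied with probability `γ(x / (k n))`. -/
def initialMeasure (γ : Torus → unitInterval) (n k : ℕ) : Measure (Config n k) :=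
  Measure.pi fun x : Site n k =>
    bernoulliMeasure true false (γ ((((x : ℕ) : ℝ) / ((k : ℝ) * (n : ℝ)) : ℝ) : Torus))

/-- The average occupation `(1/n) ∑_{x = i n}^{(i+1) n - 1} η(x)` of the `i`-th box.
The `j`-th site of that box is `finProdFinEquiv (i, j) = i n + j`. -/
def boxAverage {n k : ℕ} (η : Config n k) (i : Fin k) : ℝ :=
  (1 / (n : ℝ)) * ∑ j : Fin n, occ η (finProdFinEquiv (i, j))

/-- The averaged empirical measure `(1/k) ∑_{i < k} (average over box i) δ_{i/k}`. -/
def averagedEmpirical {n k : ℕ} (η : Config n k) : Measure Torus :=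
  ∑ i : Fin k, ENNReal.ofReal ((1 / (k : ℝ)) * boxAverage η i) •
    Measure.dirac ((((i : ℕ) : ℝ) / (k : ℝ) : ℝ) : Torus)

/-! ### Markov processes on a finite state space -/

/-- `X` is, on the probability space `(Ω, P)`, a càdlàg Markov process on the finite discrete
state space `E` with generator `A` and initial distribution `μ`. The transition semigroup is
`exp (t A)`, and the Markov property is with respect to the filtration generated by `X`. -/
structure IsMarkovProcess {Ω E : Type*} [MeasurableSpace Ω] [Fintype E] [TopologicalSpace E]
    [MeasurableSpace E] (P : Measure Ω) (A : (E → ℝ) →L[ℝ] (E → ℝ)) (μ : Measure E)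
    (X : ℝ≥0 → Ω → E) : Prop where
  measurable : ∀ t, Measurable (X t)
  rightContinuous : ∀ᵐ w ∂P, ∀ t, ContinuousWithinAt (fun s => X s w) (Ici t) t
  leftLimits : ∀ᵐ w ∂P, ∀ t, ∃ e, Tendsto (fun s => X s w) (𝓝[<] t) (𝓝 e)
  initial : P.map (X 0) = μ
  markov : ∀ (f : E → ℝ) (s t : ℝ≥0),
    P[fun w => f (X (s + t) w) | ⨆ r : ℝ≥0, ⨆ _ : r ≤ s, MeasurableSpace.comap (X r) inferInstance]
      =ᵐ[P] fun w => (NormedSpace.exp ((t : ℝ) • A)) f (X s w)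

/-! ### The heat equation on the torus -/

/-- `ρ` is a strong solution on `[0, T] × 𝕋` of `∂ₜ ρ = α Δ ρ`, `ρ₀ = γ`: it is of class
`C^{1,2}([0, T] × 𝕋)` and satisfies the equation at every point. At `t = 0` and `t = T` the time
derivative is one-sided. -/
structure IsStrongHeatSolution (α T : ℝ) (γ : Torus → ℝ) (ρ : ℝ → Torus → ℝ) : Prop where
  time_diff : ∀ t ∈ Icc 0 T, ∀ u : Torus, DifferentiableWithinAt ℝ (fun s => ρ s u) (Icc 0 T) t
  space_diff : ∀ t ∈ Icc 0 T, TorusContDiff 2 (ρ t)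
  cont : ContinuousOn (fun p : ℝ × Torus => ρ p.1 p.2) (Icc 0 T ×ˢ univ)
  cont_time_deriv : ContinuousOn
    (fun p : ℝ × Torus => derivWithin (fun s => ρ s p.2) (Icc 0 T) p.1) (Icc 0 T ×ˢ univ)
  cont_space_deriv : ∀ m : ℕ, m ≤ 2 → ContinuousOn
    (fun p : ℝ × ℝ => iteratedDeriv m (fun v : ℝ => ρ p.1 (v : Torus)) p.2) (Icc 0 T ×ˢ univ)
  equation : ∀ t ∈ Icc 0 T, ∀ u : ℝ,
    derivWithin (fun s => ρ s (u : Torus)) (Icc 0 T) t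
      = α * iteratedDeriv 2 (fun v : ℝ => ρ t (v : Torus)) u
  initial : ∀ u : Torus, ρ 0 u = γ u

end SlowBondExclusion

end

/-! The exclusion generator maps linear statistics `∑ₓ a(x) η(x)` to linear statistics, the
coefficients being acted on by the one-particle generator `lap`. The empirical pairing is such a
statistic with coefficients of order `1/(kn)`, so its fluctuation and its mean can both be read off
the one-particle flow `b`.

Fluctuation: the carré du champ of a linear statistic is at most the Dirichlet form of its
coefficients, which is half the rate at which the flow dissipates their squared `ℓ²` norm. Hence the
dynamics adds at most `1/2 ∑ a²`, of order `1/(kn)`, to the second moment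
(`integral_sq_linearStat_le`); no correlation estimate is needed.

Mean: with `b` run backwards and `ρ` forwards, `(1/kn) ∑ₓ b(t-s, x) ρ(s, box x)` is almost constant
in `s` (`IsFlow.abs_sum_sub_sum_le`). Since `ρ` is sampled once per box, only the slow bonds
contribute, with rate `k²n^(1+β) · αn^(-β) = αk²n`: this is the discrete Laplacian `αk²Δ` acting on
box averages, once the values of `b` at box ends are replaced by these averages. The replacement
costs the variation of `b` inside boxes, which Young's inequality and the energy bound make
`O(n^((1-β)/2))` after time integration, uniformly in `k`. Only `ρ` needs to be regular; for `b` the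
energy bound suffices. -/

noncomputable section

namespace SlowBondExclusion

/-! ### Algebra of the generator on linear statistics and their squares -/

section Combinatorics

variable {n k : ℕ}

/-- The forward difference `a(x + 1) - a(x)` along the bond `{x, x + 1}`. -/
def grad (a : Site n k → ℝ) (x : Site n k) : ℝ := a (next n k x) - a x

/-- The site `x - 1`, modulo `k n`. -/
def prev (n k : ℕ) (x : Site n k) : Site n k := (finRotate (k * n)).symm x

/-- The generator of a single particle with conductances `conductance α β n k`. -/
def lap (α β : ℝ) (n k : ℕ) : (Site n k → ℝ) →L[ℝ] (Site n k → ℝ) :=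
  LinearMap.toContinuousLinearMap
    { toFun := fun a x => conductance α β n k x * grad a x
        - conductance α β n k (prev n k x) * grad a (prev n k x)
      map_add' := fun a b => by
        funext x
        simp only [Pi.add_apply, grad]
        ring
      map_smul' := fun c a => by
        funext x
        simp only [Pi.smul_apply, smul_eq_mul, RingHom.id_apply, grad]
        ring }

theorem lap_apply (α β : ℝ) (a : Site n k → ℝ) (x : Site n k) :
    lap α β n k a x = conductance α β n k x * grad a x
      - conductance α β n k (prev n k x) * grad a (prev n k x) := rfl

theorem generator_apply (α β : ℝ) (f : Config n k → ℝ) (η : Config n k) :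
    generator α β n k f η
      = ∑ x : Site n k, conductance α β n k x * (f (exchange η x) - f η) := rfl

theorem conductance_nonneg {α : ℝ} (hα : 0 ≤ α) (β : ℝ) (x : Site n k) :
    0 ≤ conductance α β n k x := by
  unfold conductance
  split_ifs <;> positivity

theorem sum_prev_mul (g f : Site n k → ℝ) :
    ∑ x, g (prev n k x) * f x = ∑ x, g x * f (next n k x) := by
  rw [← Equiv.sum_comp (finRotate (k * n))]
  simp only [prev, next, Equiv.symm_apply_apply]

theorem sum_mul_lap (α β : ℝ) (f a : Site n k → ℝ) :
    ∑ x, f x * lap α β n k a x = -∑ x, conductance α β n k x * (grad a x * grad f x) := by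
  have h := sum_prev_mul (fun x => conductance α β n k x * grad a x) f
  calc ∑ x, f x * lap α β n k a x
      = ∑ x, conductance α β n k x * grad a x * f x
        - ∑ x, conductance α β n k (prev n k x) * grad a (prev n k x) * f x := by
        rw [← Finset.sum_sub_distrib]
        exact Finset.sum_congr rfl fun x _ => by rw [lap_apply]; ring
    _ = _ := by
        rw [h, ← Finset.sum_sub_distrib, ← Finset.sum_neg_distrib]
        exact Finset.sum_congr rfl fun x _ => by rw [grad, grad]; ring

/-- The linear statistic `∑ₓ a(x) η(x)`. -/
def linearStat (a : Site n k → ℝ) (η : Config n k) : ℝ := ∑ x, a x * occ η x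

theorem occ_exchange (η : Config n k) (x y : Site n k) :
    occ (exchange η x) y = occ η (Equiv.swap x (next n k x) y) := rfl

theorem linearStat_exchange_sub (a : Site n k → ℝ) (η : Config n k) (x : Site n k) :
    linearStat a (exchange η x) - linearStat a η
      = grad a x * (occ η x - occ η (next n k x)) := by
  have h1 : linearStat a (exchange η x)
      = ∑ y, a (Equiv.swap x (next n k x) y) * occ η y := by
    unfold linearStat
    rw [← Equiv.sum_comp (Equiv.swap x (next n k x))]
    simp [occ_exchange]
  rw [h1, linearStat, ← Finset.sum_sub_distrib]
  -- A site can be its own successor only on the one-site torus, where both sides vanish.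
  by_cases hx : x = next n k x
  · simp [grad, ← hx]
  · rw [Finset.sum_eq_add (s := Finset.univ) x (next n k x) hx]
    · simp only [Equiv.swap_apply_left, Equiv.swap_apply_right, grad]
      ring
    · rintro c - ⟨h2, h3⟩
      rw [Equiv.swap_apply_of_ne_of_ne h2 h3, sub_self]
    · simp
    · simp

/-- Each bond term is linear in `η`, the exclusion rule cancelling in a symmetric exchange;
summation by parts then moves the differences onto the coefficients. -/
theorem generator_linearStat (α β : ℝ) (a : Site n k → ℝ) :
    generator α β n k (linearStat a) = linearStat (lap α β n k a) := by
  funext η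
  have h := sum_prev_mul (fun x => conductance α β n k x * grad a x) (occ η)
  rw [generator_apply]
  simp only [linearStat_exchange_sub]
  simp only [linearStat, lap_apply, sub_mul, Finset.sum_sub_distrib]
  rw [h, ← Finset.sum_sub_distrib]
  exact Finset.sum_congr rfl fun x _ => by ring

theorem occ_sub_sq_le_one (η : Config n k) (x y : Site n k) : (occ η x - occ η y) ^ 2 ≤ 1 := by
  unfold occ
  split_ifs <;> norm_num

/-- The chain rule for squares leaves the carré du champ as error; an exchange changes the statistic
by at most `|grad a x|`, as occupations lie in `{0, 1}`. -/
theorem generator_sq_linearStat_le {α : ℝ} (hα : 0 ≤ α) (β : ℝ) (a : Site n k → ℝ) (m : ℝ)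
    (η : Config n k) :
    generator α β n k (fun ζ => (linearStat a ζ - m) ^ 2) η
      ≤ 2 * (linearStat a η - m) * linearStat (lap α β n k a) η
        + ∑ x, conductance α β n k x * grad a x ^ 2 := by
  rw [← generator_linearStat, generator_apply, generator_apply, Finset.mul_sum,
    ← Finset.sum_add_distrib]
  refine Finset.sum_le_sum fun x _ => ?_
  have h := linearStat_exchange_sub a η x
  have h2 : (linearStat a (exchange η x) - m) ^ 2 - (linearStat a η - m) ^ 2
      = 2 * (linearStat a η - m) * (linearStat a (exchange η x) - linearStat a η)
        + grad a x ^ 2 * (occ η x - occ η (next n k x)) ^ 2 := by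
    rw [← mul_pow, ← h]
    ring
  have h3 : grad a x ^ 2 * (occ η x - occ η (next n k x)) ^ 2 ≤ grad a x ^ 2 :=
    mul_le_of_le_one_right (sq_nonneg _) (occ_sub_sq_le_one _ _ _)
  have h4 := mul_le_mul_of_nonneg_left h3 (conductance_nonneg hα β x)
  rw [h2]
  linarith

theorem generator_const (α β : ℝ) (c : ℝ) (η : Config n k) :
    generator α β n k (fun _ => c) η = 0 := by
  simp [generator_apply]

end Combinatorics

/-! ### One-particle flow and its energy dissipation -/

section Flow

variable {n k : ℕ}

/-- `a` solves the backward equation `∂ᵣ a = c · lap a` of a single particle at speed `c`. -/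
def IsFlow (α β c : ℝ) (n k : ℕ) (a : ℝ → Site n k → ℝ) : Prop :=
  ∀ r, HasDerivAt a (c • lap α β n k (a r)) r

theorem exists_isFlow (α β c : ℝ) (a₀ : Site n k → ℝ) :
    ∃ a, IsFlow α β c n k a ∧ a 0 = a₀ := by
  refine ⟨fun r => NormedSpace.exp (r • (c • lap α β n k)) a₀, fun r => ?_, ?_⟩
  · have h := (hasDerivAt_exp_smul_const' (c • lap α β n k) r).clm_apply (hasDerivAt_const r a₀)
    simpa using h
  · simp

variable {α β c : ℝ} {a : ℝ → Site n k → ℝ}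

theorem IsFlow.hasDerivAt_apply (h : IsFlow α β c n k a) (r : ℝ) (x : Site n k) :
    HasDerivAt (fun r => a r x) (c * lap α β n k (a r) x) r := by
  simpa using (hasDerivAt_pi.1 (h r)) x

theorem IsFlow.const_mul (h : IsFlow α β c n k a) (d : ℝ) :
    IsFlow α β c n k (fun r => d • a r) := fun r => by
  have := (h r).const_smul d
  rwa [smul_comm, ← map_smul] at this

/-- The Dirichlet form `c ∑ₓ ξₓ (a(x + 1) - a(x))²`. -/
def dirichlet (α β c : ℝ) (a : Site n k → ℝ) : ℝ :=
  c * ∑ x, conductance α β n k x * grad a x ^ 2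

theorem IsFlow.hasDerivAt_sum_sq (h : IsFlow α β c n k a) (r : ℝ) :
    HasDerivAt (fun r => ∑ x, a r x ^ 2) (-(2 * dirichlet α β c (a r))) r := by
  have h1 : HasDerivAt (fun r => ∑ x, a r x ^ 2)
      (∑ x, 2 * a r x * (c * lap α β n k (a r) x)) r := by
    refine HasDerivAt.fun_sum fun x _ => ?_
    simpa using (h.hasDerivAt_apply r x).fun_pow 2
  convert h1 using 1
  have h2 := sum_mul_lap α β (a r) (a r)
  calc -(2 * dirichlet α β c (a r))
      = 2 * c * -∑ x, conductance α β n k x * (grad (a r) x * grad (a r) x) := by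
        simp only [dirichlet, sq]
        ring
    _ = _ := by
        rw [← h2, Finset.mul_sum]
        exact Finset.sum_congr rfl fun x _ => by ring

theorem dirichlet_nonneg (hα : 0 ≤ α) (hc : 0 ≤ c) (a : Site n k → ℝ) :
    0 ≤ dirichlet α β c a :=
  mul_nonneg hc (Finset.sum_nonneg fun x _ =>
    mul_nonneg (conductance_nonneg hα β x) (sq_nonneg _))

theorem IsFlow.sum_sq_le (h : IsFlow α β c n k a) (hα : 0 ≤ α) (hc : 0 ≤ c) {r : ℝ}
    (hr : 0 ≤ r) : ∑ x, a r x ^ 2 ≤ ∑ x, a 0 x ^ 2 := by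
  have : Antitone fun r => ∑ x, a r x ^ 2 := by
    refine antitone_of_hasDerivAt_nonpos (fun r => h.hasDerivAt_sum_sq r) fun r => ?_
    have := dirichlet_nonneg (β := β) hα hc (a r)
    simp only [Pi.zero_apply]
    linarith
  exact this hr

end Flow

/-! ### Second moments along the process -/

section Markov

theorem IsMarkovProcess.integral_comp {Ω E : Type*} [MeasurableSpace Ω] [Fintype E]
    [TopologicalSpace E] [MeasurableSpace E] [MeasurableSingletonClass E] {P : Measure Ω}
    [IsProbabilityMeasure P] {A : (E → ℝ) →L[ℝ] (E → ℝ)} {μ : Measure E} {X : ℝ≥0 → Ω → E}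
    (hX : IsMarkovProcess P A μ X) (f : E → ℝ) (t : ℝ≥0) :
    ∫ w, f (X t w) ∂P = ∫ e, NormedSpace.exp ((t : ℝ) • A) f e ∂μ := by
  have hm : (⨆ r : ℝ≥0, ⨆ _ : r ≤ 0, MeasurableSpace.comap (X r) inferInstance)
      ≤ (inferInstance : MeasurableSpace Ω) :=
    iSup_le fun r => iSup_le fun _ => (hX.measurable r).comap_le
  have h1 := integral_condExp (μ := P) (f := fun w => f (X (0 + t) w)) hm
  rw [integral_congr_ae (hX.markov f 0 t), zero_add] at h1
  rw [← h1, ← hX.initial, integral_map (hX.measurable 0).aemeasurable]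
  exact (measurable_of_countable _).aestronglyMeasurable

variable {n k : ℕ} {α β c : ℝ} {Ω : Type*} [MeasurableSpace Ω] {P : Measure Ω}
  [IsProbabilityMeasure P] {μ : Measure (Config n k)} {X : ℝ≥0 → Ω → Config n k}

theorem IsFlow.hasDerivAt_linearStat {a : ℝ → Site n k → ℝ} (ha : IsFlow α β c n k a)
    (η : Config n k) (r : ℝ) :
    HasDerivAt (fun r => linearStat (a r) η) (c * linearStat (lap α β n k (a r)) η) r := by
  have h : HasDerivAt (fun r => ∑ x, a r x * occ η x)
      (∑ x, c * lap α β n k (a r) x * occ η x) r :=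
    HasDerivAt.fun_sum fun x _ => (ha.hasDerivAt_apply r x).mul_const _
  simpa only [linearStat, Finset.mul_sum, mul_assoc] using h

/-- Second moments of linear statistics of the exclusion process are controlled by those of the
initial measure, up to the `ℓ²` norm of the coefficients. -/
theorem integral_sq_linearStat_le [IsProbabilityMeasure μ]
    (hX : IsMarkovProcess P (c • generator α β n k) μ X) (hα : 0 ≤ α) (hc : 0 ≤ c)
    {a : ℝ → Site n k → ℝ} (ha : IsFlow α β c n k a) (m : ℝ) (t : ℝ≥0) :
    ∫ w, (linearStat (a 0) (X t w) - m) ^ 2 ∂P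
      ≤ ∫ η, (linearStat (a t) η - m) ^ 2 ∂μ + 1 / 2 * ∑ x, a 0 x ^ 2 := by
  set A := c • generator α β n k with hA
  -- Duhamel interpolation between time `0` and time `t`. The subtracted `ℓ²` term absorbs the carré
  -- du champ, since its `s`-derivative is minus the Dirichlet form.
  let g : ℝ → Config n k → ℝ := fun s η =>
    (linearStat (a (t - s)) η - m) ^ 2 - 1 / 2 * ∑ x, a (t - s) x ^ 2
  let g' : ℝ → Config n k → ℝ := fun s η =>
    -(2 * (linearStat (a (t - s)) η - m) * (c * linearStat (lap α β n k (a (t - s))) η))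
      - dirichlet α β c (a (t - s))
  have hg : ∀ s, HasDerivAt g (g' s) s := by
    intro s
    refine hasDerivAt_pi.2 fun η => ?_
    have h1 : HasDerivAt (fun s : ℝ => (t : ℝ) - s) (-1) s := by
      simpa using (hasDerivAt_id s).const_sub (t : ℝ)
    have h2 := (((ha.hasDerivAt_linearStat η (t - s)).sub_const m).fun_pow 2).comp s h1
    have h3 := ((ha.hasDerivAt_sum_sq (t - s)).const_mul (1 / 2)).comp s h1
    refine (h2.fun_sub h3).congr_deriv ?_
    simp only [g']
    push_cast
    ring
  have hle : ∀ s η, A (g s) η + g' s η ≤ 0 := by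
    intro s η
    have h1 : g s = (fun ζ => (linearStat (a (t - s)) ζ - m) ^ 2)
        - fun _ => 1 / 2 * ∑ x, a (t - s) x ^ 2 := rfl
    have h2 := mul_le_mul_of_nonneg_left
      (generator_sq_linearStat_le hα β (a (t - s)) m η) hc
    rw [h1, map_sub, Pi.sub_apply, hA]
    simp only [_root_.smul_apply, Pi.smul_apply, smul_eq_mul, generator_const,
      mul_zero, sub_zero, g', dirichlet]
    linarith
  have hint : ∀ f : Config n k → ℝ, ∫ η, f η ∂μ = ∑ η, μ.real {η} * f η := fun f => by
    simpa using integral_fintype (μ := μ) (f := f) .of_finite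
  let φ : ℝ → ℝ := fun s => ∫ η, NormedSpace.exp (s • A) (g s) η ∂μ
  have hφ : ∀ s, HasDerivAt φ (∫ η, NormedSpace.exp (s • A) (A (g s) + g' s) η ∂μ) s := by
    intro s
    have h1 := (hasDerivAt_exp_smul_const A s).clm_apply (hg s)
    have hφ' : φ = fun s => ∑ η, μ.real {η} * NormedSpace.exp (s • A) (g s) η :=
      funext fun s => hint _
    rw [hφ', hint]
    refine HasDerivAt.fun_sum fun η _ => HasDerivAt.const_mul _ ?_
    refine ((hasDerivAt_pi.1 h1) η).congr_deriv ?_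
    simp [map_add]
  have hanti : AntitoneOn φ (Icc 0 t) := by
    refine antitoneOn_of_hasDerivWithinAt_nonpos (convex_Icc _ _)
      (fun s _ => (hφ s).continuousAt.continuousWithinAt)
      (fun s _ => (hφ s).hasDerivWithinAt) fun s hs => ?_
    rw [interior_Icc] at hs
    -- Positivity of the semigroup is replaced by its probabilistic meaning: the derivative of `φ`
    -- is the expectation of a nonpositive function of the process.
    have h1 := hX.integral_comp (A (g s) + g' s) ⟨s, hs.1.le⟩
    exact h1.symm.trans_le (integral_nonpos fun w => hle s _)
  have h0 : φ 0 = ∫ η, (linearStat (a t) η - m) ^ 2 ∂μ - 1 / 2 * ∑ x, a t x ^ 2 := by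
    simp only [φ, g, zero_smul, NormedSpace.exp_zero, one_apply_eq_self, sub_zero]
    rw [integral_sub .of_finite .of_finite]
    simp
  have ht : φ t = ∫ w, (linearStat (a 0) (X t w) - m) ^ 2 ∂P - 1 / 2 * ∑ x, a 0 x ^ 2 := by
    simp only [φ]
    rw [← hX.integral_comp (g t) t]
    simp only [g, sub_self]
    rw [integral_sub _ (integrable_const _)]
    · simp
    · obtain ⟨C, hC⟩ := (Set.finite_range
        fun η : Config n k => ‖(linearStat (a 0) η - m) ^ 2‖).bddAbove
      refine Integrable.of_bound (C := C) ?_ (ae_of_all _ fun w => hC ⟨X t w, rfl⟩)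
      exact ((measurable_of_countable fun η : Config n k =>
        (linearStat (a 0) η - m) ^ 2).comp (hX.measurable t)).aestronglyMeasurable
  have h1 := hanti (left_mem_Icc.2 t.2) (right_mem_Icc.2 t.2) t.2
  rw [h0, ht] at h1
  have h2 : 0 ≤ ∑ x, a t x ^ 2 := Finset.sum_nonneg fun x _ => sq_nonneg _
  linarith

end Markov

/-! ### Bias and variance under the initial product measure -/

section Initial

variable {n k : ℕ}

instance (γ : Torus → unitInterval) : IsProbabilityMeasure (initialMeasure γ n k) := by
  unfold initialMeasure
  infer_instance

theorem integral_sq_linearStat_initialMeasure_le (γ : Torus → unitInterval)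
    (a : Site n k → ℝ) (m : ℝ) :
    ∫ η, (linearStat a η - m) ^ 2 ∂(initialMeasure γ n k)
      ≤ 1 / 4 * ∑ x, a x ^ 2
        + (∑ x, a x * γ ((((x : ℕ) : ℝ) / ((k : ℝ) * (n : ℝ)) : ℝ) : Torus) - m) ^ 2 := by
  set p : Site n k → unitInterval :=
    fun x => γ ((((x : ℕ) : ℝ) / ((k : ℝ) * (n : ℝ)) : ℝ) : Torus) with hp
  set μ := initialMeasure γ n k with hμ
  let Y : Site n k → Bool → ℝ := fun x e => a x * if e then 1 else 0
  have hY : linearStat a = ∑ x, fun η : Config n k => Y x (η x) := by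
    funext η
    simp [linearStat, occ, Y]
  have hvar : Var[linearStat a; μ] ≤ 1 / 4 * ∑ x, a x ^ 2 := by
    rw [hY, hμ, initialMeasure, variance_sum_pi fun x => .of_discrete, Finset.mul_sum]
    refine Finset.sum_le_sum fun x _ => ?_
    -- A variable with values in `[0, 1]` has variance at most `1/4`, whatever the profile.
    have h1 := variance_le_sq_of_bounded (μ := bernoulliMeasure true false (p x))
      (X := fun e : Bool => if e then (1 : ℝ) else 0) (a := 0) (b := 1)
      (ae_of_all _ fun e => by cases e <;> simp) (measurable_of_countable _).aemeasurable
    simp only [Y]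
    rw [variance_const_mul]
    nlinarith [sq_nonneg (a x)]
  have hmean : ∫ η, linearStat a η ∂μ = ∑ x, a x * (p x : ℝ) := by
    simp only [linearStat]
    rw [integral_finsetSum _ fun x _ => .of_finite]
    refine Finset.sum_congr rfl fun x _ => ?_
    rw [integral_const_mul]
    congr 1
    have h1 := integral_comp_eval (μ := fun x => bernoulliMeasure true false (p x)) (i := x)
      (f := fun e : Bool => if e then (1 : ℝ) else 0)
      (measurable_of_countable _).aestronglyMeasurable
    rw [integral_bernoulliMeasure] at h1
    simpa [occ, hμ, initialMeasure] using h1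
  have hsplit : ∫ η, (linearStat a η - m) ^ 2 ∂μ
      = Var[linearStat a; μ] + (∫ η, linearStat a η ∂μ - m) ^ 2 := by
    have h1 := variance_eq_sub (μ := μ) (X := fun η => linearStat a η - m) .of_discrete
    rw [variance_sub_const (measurable_of_countable _).aestronglyMeasurable,
      integral_sub .of_finite .of_finite] at h1
    simp only [Pi.pow_apply, integral_const, probReal_univ, one_smul] at h1
    linarith
  rw [hsplit, hmean]
  linarith

end Initial

/-! ### Box geometry, flux through slow bonds, variation inside boxes -/

section Boxes

theorem val_finRotate {N : ℕ} (x : Fin N) : (finRotate N x : ℕ) = ((x : ℕ) + 1) % N := by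
  cases N with
  | zero => exact x.elim0
  | succ N => simp [finRotate_apply, Fin.val_add]

variable {m k : ℕ}

theorem next_castSucc (i : Fin k) (j : Fin m) :
    next (m + 1) k (finProdFinEquiv (i, j.castSucc)) = finProdFinEquiv (i, j.succ) := by
  apply Fin.ext
  have hx := (finProdFinEquiv (i, j.succ)).2
  rw [next, val_finRotate]
  simp only [finProdFinEquiv_apply_val, Fin.val_castSucc, Fin.val_succ] at hx ⊢
  rw [Nat.mod_eq_of_lt] <;> omega

theorem next_last (i : Fin k) :
    next (m + 1) k (finProdFinEquiv (i, Fin.last m)) = finProdFinEquiv (finRotate k i, 0) := by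
  apply Fin.ext
  rw [next, val_finRotate]
  simp only [finProdFinEquiv_apply_val, Fin.val_last, Fin.val_zero, val_finRotate]
  rw [show m + (m + 1) * (i : ℕ) + 1 = (m + 1) * ((i : ℕ) + 1) by ring, mul_comm k,
    Nat.mul_mod_mul_left, zero_add]

theorem conductance_castSucc (α β : ℝ) (i : Fin k) (j : Fin m) :
    conductance α β (m + 1) k (finProdFinEquiv (i, j.castSucc)) = 1 := by
  rw [conductance, if_neg]
  simp only [finProdFinEquiv_apply_val, Fin.val_castSucc]
  rw [show (j : ℕ) + (m + 1) * i + 1 = (j + 1) + (m + 1) * i by ring,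
    Nat.dvd_add_left (dvd_mul_right _ _)]
  intro h
  have := Nat.le_of_dvd (Nat.succ_pos _) h
  omega

theorem conductance_last (α β : ℝ) (i : Fin k) :
    conductance α β (m + 1) k (finProdFinEquiv (i, Fin.last m))
      = α * ((m + 1 : ℕ) : ℝ) ^ (-β) := by
  rw [conductance, if_pos]
  simp only [finProdFinEquiv_apply_val, Fin.val_last]
  exact ⟨i + 1, by ring⟩

/-- The box containing a site. -/
def box {n k : ℕ} (x : Site n k) : Fin k := (finProdFinEquiv.symm x).1

@[simp]
theorem box_finProdFinEquiv {n : ℕ} (p : Fin k × Fin n) : box (finProdFinEquiv p) = p.1 := by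
  simp [box]

theorem sum_site {n : ℕ} (f : Site n k → ℝ) :
    ∑ x, f x = ∑ i : Fin k, ∑ j : Fin n, f (finProdFinEquiv (i, j)) := by
  rw [← Equiv.sum_comp finProdFinEquiv, Fintype.sum_prod_type]

/-- The total variation of a function inside the boxes. -/
def boxVariation (B : Fin k → Fin (m + 1) → ℝ) : ℝ :=
  ∑ i, ∑ l : Fin m, |B i l.succ - B i l.castSucc|

theorem abs_sub_zero_le_sum (f : Fin (m + 1) → ℝ) (j : Fin (m + 1)) :
    |f j - f 0| ≤ ∑ l : Fin m, |f l.succ - f l.castSucc| := by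
  induction m with
  | zero =>
    rw [Fin.fin_one_eq_zero j]
    simp
  | succ m ih =>
    have h := ih (fun l => f l.castSucc)
    rw [Fin.sum_univ_castSucc]
    simp only [Fin.castSucc_zero, Fin.succ_castSucc] at h ⊢
    cases j using Fin.lastCases with
    | last =>
      have h1 := h (Fin.last m)
      have h2 := abs_sub_le (f (Fin.last (m + 1))) (f (Fin.last m).castSucc) (f 0)
      rw [Fin.succ_last]
      linarith
    | cast j => linarith [h j, abs_nonneg (f (Fin.last m).succ - f (Fin.last m).castSucc)]

/-- Summation by parts over the boxes: the flux through the bonds between consecutive boxes is,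
up to the variation inside the boxes, a discrete Laplacian tested against box sums. -/
theorem abs_flux_add_le (hk : 0 < k) (B : Fin k → Fin (m + 1) → ℝ) (r q : Fin k → ℝ) {K δ : ℝ}
    (hK : ∀ i, |r (finRotate k i) - r i| ≤ K / k)
    (hδ : ∀ i, |(k : ℝ) ^ 2 * (r (finRotate k i) - 2 * r i + r ((finRotate k).symm i)) - q i| ≤ δ) :
    |(k : ℝ) ^ 2 * (m + 1) * ∑ i, (B (finRotate k i) 0 - B i (Fin.last m))
          * (r (finRotate k i) - r i) + ∑ i, ∑ j, B i j * q i|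
      ≤ (k : ℝ) * (m + 1) * (3 * K * boxVariation B) + δ * ∑ i, ∑ j, |B i j| := by
  have hk' : (0 : ℝ) < k := by exact_mod_cast hk
  let σ := finRotate k
  let V : Fin k → ℝ := fun i => ∑ l : Fin m, |B i l.succ - B i l.castSucc|
  let d : Fin k → ℝ := fun i => r (σ i) - r i
  have hV : ∀ i j, |B i j - B i 0| ≤ V i := fun i j => abs_sub_zero_le_sum (B i) j
  -- Error in replacing the jump `B (σ i) 0 - B i last` by `B (σ i) j - B i j`. Summing over `j`
  -- turns the jump into a difference of box sums.
  let e : Fin k → Fin (m + 1) → ℝ := fun i j =>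
    (B (σ i) 0 - B (σ i) j) + (B i j - B i (Fin.last m))
  have he : ∀ i j, |e i j| ≤ V (σ i) + 2 * V i := by
    intro i j
    have h1 := abs_le.1 (hV (σ i) j)
    have h2 := abs_le.1 (hV i j)
    have h3 := abs_le.1 (hV i (Fin.last m))
    refine abs_le.2 ⟨?_, ?_⟩ <;> simp only [e] <;> linarith
  have hsplit : (k : ℝ) ^ 2 * (m + 1) * ∑ i, (B (σ i) 0 - B i (Fin.last m)) * d i
        + ∑ i, ∑ j, B i j * q i
      = (k : ℝ) ^ 2 * ∑ i, ∑ j, e i j * d i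
        - ∑ i, ∑ j, B i j * ((k : ℝ) ^ 2 * (r (σ i) - 2 * r i + r (σ.symm i)) - q i) := by
    have h1 : ∑ i, ∑ j, B (σ i) j * d i = ∑ i, ∑ j, B i j * d (σ.symm i) := by
      rw [← Equiv.sum_comp σ (fun i => ∑ j, B i j * d (σ.symm i))]
      simp
    have h2 : ((m : ℝ) + 1) * ∑ i, (B (σ i) 0 - B i (Fin.last m)) * d i
        = ∑ i, ∑ j, e i j * d i + ∑ i, ∑ j, B (σ i) j * d i - ∑ i, ∑ j, B i j * d i := by
      rw [← Finset.sum_add_distrib, ← Finset.sum_sub_distrib, Finset.mul_sum]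
      refine Finset.sum_congr rfl fun i _ => ?_
      rw [← Finset.sum_add_distrib, ← Finset.sum_sub_distrib]
      rw [Finset.sum_congr rfl (g := fun _ : Fin (m + 1) =>
        (B (σ i) 0 - B i (Fin.last m)) * d i) fun j _ => by simp only [e]; ring]
      simp
    have h3 : ∑ i, ∑ j, B i j * ((k : ℝ) ^ 2 * (r (σ i) - 2 * r i + r (σ.symm i)) - q i)
        = (k : ℝ) ^ 2 * (∑ i, ∑ j, B i j * d i - ∑ i, ∑ j, B i j * d (σ.symm i))
          - ∑ i, ∑ j, B i j * q i := by
      simp only [← Finset.sum_sub_distrib, Finset.mul_sum]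
      refine Finset.sum_congr rfl fun i _ => Finset.sum_congr rfl fun j _ => ?_
      simp only [d, Equiv.apply_symm_apply]
      ring
    rw [mul_assoc, h2, h3, h1]
    ring
  have hb1 : |(k : ℝ) ^ 2 * ∑ i, ∑ j, e i j * d i|
      ≤ (k : ℝ) * (m + 1) * (3 * K * boxVariation B) := by
    have hVnn : ∀ i, 0 ≤ V i := fun i => Finset.sum_nonneg fun l _ => abs_nonneg _
    have h1 : |∑ i, ∑ j, e i j * d i| ≤ ∑ i, ∑ _j : Fin (m + 1), (V (σ i) + 2 * V i) * (K / k) := by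
      refine (Finset.abs_sum_le_sum_abs _ _).trans (Finset.sum_le_sum fun i _ => ?_)
      refine (Finset.abs_sum_le_sum_abs _ _).trans (Finset.sum_le_sum fun j _ => ?_)
      rw [abs_mul]
      exact mul_le_mul (he i j) (hK i) (abs_nonneg _)
        (by have := hVnn i; have := hVnn (σ i); positivity)
    have h2 : ∑ i, ∑ _j : Fin (m + 1), (V (σ i) + 2 * V i) * (K / k)
        = (m + 1) * (3 * boxVariation B) * (K / k) := by
      have h3 : ∑ i, V (σ i) = boxVariation B := Equiv.sum_comp σ V
      have h4 : ∑ i, V i = boxVariation B := rfl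
      simp only [Finset.sum_const, Finset.card_univ, Fintype.card_fin, nsmul_eq_mul]
      rw [← Finset.mul_sum, ← Finset.sum_mul, Finset.sum_add_distrib, ← Finset.mul_sum, h3, h4]
      push_cast
      ring
    rw [abs_mul, abs_of_nonneg (by positivity : (0 : ℝ) ≤ (k : ℝ) ^ 2)]
    calc (k : ℝ) ^ 2 * |∑ i, ∑ j, e i j * d i|
        ≤ (k : ℝ) ^ 2 * ((m + 1) * (3 * boxVariation B) * (K / k)) := by
          rw [← h2]
          gcongr
      _ = _ := by field_simp
  have hb2 : |∑ i, ∑ j, B i j * ((k : ℝ) ^ 2 * (r (σ i) - 2 * r i + r (σ.symm i)) - q i)|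
      ≤ δ * ∑ i, ∑ j, |B i j| := by
    simp only [Finset.mul_sum]
    refine (Finset.abs_sum_le_sum_abs _ _).trans (Finset.sum_le_sum fun i _ => ?_)
    refine (Finset.abs_sum_le_sum_abs _ _).trans (Finset.sum_le_sum fun j _ => ?_)
    rw [abs_mul, mul_comm]
    exact mul_le_mul_of_nonneg_right (hδ i) (abs_nonneg _)
  change |(k : ℝ) ^ 2 * (m + 1) * ∑ i, (B (σ i) 0 - B i (Fin.last m)) * d i
        + ∑ i, ∑ j, B i j * q i| ≤ _
  rw [hsplit]
  exact (abs_sub _ _).trans (add_le_add hb1 hb2)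

/-- A function of the sites, arranged in boxes. -/
def inBoxes {n : ℕ} (b : Site n k → ℝ) (i : Fin k) (j : Fin n) : ℝ := b (finProdFinEquiv (i, j))

/-- A function of the box alone has zero gradient on the bonds inside boxes, so only the slow bonds
survive. -/
theorem sum_conductance_grad_box (α β : ℝ) (b : Site (m + 1) k → ℝ) (r : Fin k → ℝ) :
    ∑ x, conductance α β (m + 1) k x * (grad b x * grad (fun y => r (box y)) x)
      = α * ((m + 1 : ℕ) : ℝ) ^ (-β) * ∑ i, (inBoxes b (finRotate k i) 0
          - inBoxes b i (Fin.last m)) * (r (finRotate k i) - r i) := by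
  rw [sum_site, Finset.mul_sum]
  refine Finset.sum_congr rfl fun i _ => ?_
  rw [Fin.sum_univ_castSucc]
  simp [grad, next_castSucc, next_last, conductance_last, inBoxes]

theorem sum_sq_interior_le {α : ℝ} (hα : 0 ≤ α) (β : ℝ) (b : Site (m + 1) k → ℝ) :
    ∑ i, ∑ l : Fin m, (inBoxes b i l.succ - inBoxes b i l.castSucc) ^ 2
      ≤ ∑ x, conductance α β (m + 1) k x * grad b x ^ 2 := by
  rw [sum_site]
  refine Finset.sum_le_sum fun i _ => ?_
  rw [Fin.sum_univ_castSucc]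
  simp only [conductance_castSucc, grad, next_castSucc, one_mul, inBoxes]
  exact le_add_of_nonneg_right (mul_nonneg (conductance_nonneg hα β _) (sq_nonneg _))

/-- Young's inequality on the interior bonds, whose conductance is `1`, trades the `ℓ¹` variation
for the Dirichlet form. The accelerated clock makes this form expensive, whence the small factor
when `β > 1`. -/
theorem boxVariation_le (hk : 0 < k) {α : ℝ} (hα : 0 ≤ α) (β : ℝ) (b : Site (m + 1) k → ℝ) :
    boxVariation (inBoxes b) ≤ ((m + 1 : ℕ) : ℝ) ^ ((1 - β) / 2) / 2
      * (1 + dirichlet α β ((k : ℝ) ^ 2 * ((m + 1 : ℕ) : ℝ) ^ (1 + β)) b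
          / (k * (m + 1 : ℕ))) := by
  have hk' : (0 : ℝ) < k := by exact_mod_cast hk
  set n : ℝ := ((m + 1 : ℕ) : ℝ) with hn
  have hn0 : 0 < n := by simp only [hn]; positivity
  set κ := n ^ ((1 - β) / 2) with hκ
  have hκ0 : 0 < κ := Real.rpow_pos_of_pos hn0 _
  have hκn : κ * κ * n ^ (1 + β) = n * n := by
    rw [hκ, ← Real.rpow_add hn0, ← Real.rpow_add hn0,
      show (1 - β) / 2 + (1 - β) / 2 + (1 + β) = 1 + 1 by ring, Real.rpow_add hn0, Real.rpow_one]
  -- Young's parameter: the at most `kn` terms `θ / 2` sum to at most `κ / 2`, and `κ² n^(1+β) = n²`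
  -- gives the quadratic part the same prefactor.
  set θ := κ / (k * n) with hθ
  have hθ0 : 0 < θ := by positivity
  set S := ∑ i, ∑ l : Fin m, (inBoxes b i l.succ - inBoxes b i l.castSucc) ^ 2 with hS
  have h1 : boxVariation (inBoxes b) ≤ ∑ _i : Fin k, ∑ _l : Fin m, θ / 2 + S / (2 * θ) := by
    rw [hS, Finset.sum_div, ← Finset.sum_add_distrib]
    refine Finset.sum_le_sum fun i _ => ?_
    rw [Finset.sum_div, ← Finset.sum_add_distrib]
    refine Finset.sum_le_sum fun l _ => ?_
    set g := inBoxes b i l.succ - inBoxes b i l.castSucc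
    rw [← sq_abs g, ← sub_nonneg,
      show θ / 2 + |g| ^ 2 / (2 * θ) - |g| = (|g| - θ) ^ 2 / (2 * θ) by field_simp; ring]
    positivity
  have h2 : ∑ _i : Fin k, ∑ _l : Fin m, θ / 2 ≤ κ / 2 := by
    simp only [Finset.sum_const, Finset.card_univ, Fintype.card_fin, nsmul_eq_mul]
    have hmn : (m : ℝ) ≤ n := by simp [hn]
    calc (k : ℝ) * (m * (θ / 2)) ≤ k * (n * (θ / 2)) := by gcongr
      _ = κ / 2 := by rw [hθ]; field_simp
  have h3 : S / (2 * θ) ≤ κ / 2 * (dirichlet α β ((k : ℝ) ^ 2 * n ^ (1 + β)) b / (k * n)) := by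
    have h4 := sum_sq_interior_le hα β b
    rw [dirichlet]
    set D := ∑ x, conductance α β (m + 1) k x * grad b x ^ 2
    calc S / (2 * θ) ≤ D / (2 * θ) := by gcongr
      _ = κ / 2 * ((k : ℝ) ^ 2 * n ^ (1 + β) * D / (k * n)) := by
        rw [hθ]
        field_simp
        linear_combination -(D * hκn)
  linarith

end Boxes

/-! ### Evolution of the mean against the heat solution -/

section Mean

variable {m k : ℕ}

theorem IsFlow.sum_sq_le_of_abs_le {n k : ℕ} {α β c : ℝ} {b : ℝ → Site n k → ℝ}
    (hb : IsFlow α β c n k b) (hα : 0 ≤ α) (hc : 0 ≤ c) {C : ℝ} (hC : ∀ x, |b 0 x| ≤ C)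
    {r : ℝ} (hr : 0 ≤ r) : ∑ x, b r x ^ 2 ≤ (k : ℝ) * n * C ^ 2 := by
  refine (hb.sum_sq_le hα hc hr).trans ?_
  have hcard : ((Finset.univ : Finset (Site n k)).card : ℝ) = k * n := by simp
  rw [← hcard, ← nsmul_eq_mul]
  exact Finset.sum_le_card_nsmul _ _ _ fun x _ => by
    rw [← sq_abs]
    exact pow_le_pow_left₀ (abs_nonneg _) (hC x) 2

theorem IsFlow.sum_abs_le_of_abs_le {n k : ℕ} {α β c : ℝ} {b : ℝ → Site n k → ℝ}
    (hb : IsFlow α β c n k b) (hα : 0 ≤ α) (hc : 0 ≤ c) {C : ℝ} (hC : ∀ x, |b 0 x| ≤ C)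
    {r : ℝ} (hr : 0 ≤ r) : ∑ x, |b r x| ≤ (k : ℝ) * n * ((1 + C ^ 2) / 2) := by
  have hcard : ((Finset.univ : Finset (Site n k)).card : ℝ) = k * n := by simp
  have h1 : ∑ x, |b r x| ≤ ∑ x, (1 / 2 + b r x ^ 2 / 2) := by
    refine Finset.sum_le_sum fun x _ => ?_
    nlinarith [sq_nonneg (|b r x| - 1), sq_abs (b r x)]
  rw [Finset.sum_add_distrib, ← Finset.sum_div _ _ (2 : ℝ), ← Finset.sum_div _ _ (2 : ℝ),
    Finset.sum_const, nsmul_eq_mul, hcard] at h1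
  linarith [hb.sum_sq_le_of_abs_le hα hc hC hr]

/-- A solution of the one-particle equation is almost constant in time when tested against a
function of the boxes that solves an approximate discrete heat equation backwards in time. -/
theorem IsFlow.abs_sum_sub_sum_le (hk : 0 < k) {α β : ℝ} (hα : 0 ≤ α)
    {b : ℝ → Site (m + 1) k → ℝ}
    (hb : IsFlow α β ((k : ℝ) ^ 2 * ((m + 1 : ℕ) : ℝ) ^ (1 + β)) (m + 1) k b)
    {C : ℝ} (hC : ∀ x, |b 0 x| ≤ C) {t : ℝ} (ht : 0 ≤ t) {r q : ℝ → Fin k → ℝ} {K δ : ℝ}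
    (hr : ∀ i, ContinuousOn (fun s => r s i) (Icc 0 t))
    (hr' : ∀ i, ∀ s ∈ Ico 0 t, HasDerivWithinAt (fun s => r s i) (α * q s i) (Ici s) s)
    (hK : ∀ s ∈ Ico 0 t, ∀ i, |r s (finRotate k i) - r s i| ≤ K / k)
    (hδ : ∀ s ∈ Ico 0 t, ∀ i, |(k : ℝ) ^ 2 * (r s (finRotate k i) - 2 * r s i
      + r s ((finRotate k).symm i)) - q s i| ≤ δ) (hK0 : 0 ≤ K) (hδ0 : 0 ≤ δ) :
    |1 / ((k : ℝ) * (m + 1 : ℕ)) * ∑ x, b 0 x * r t (box x)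
        - 1 / ((k : ℝ) * (m + 1 : ℕ)) * ∑ x, b t x * r 0 (box x)|
      ≤ α * (3 * K * (((m + 1 : ℕ) : ℝ) ^ ((1 - β) / 2) / 2) * (t + C ^ 2 / 2)
        + δ * t * ((1 + C ^ 2) / 2)) := by
  have hk' : (0 : ℝ) < k := by exact_mod_cast hk
  set n : ℝ := ((m + 1 : ℕ) : ℝ) with hn
  have hn0 : 0 < n := by simp only [hn]; positivity
  set c := (k : ℝ) ^ 2 * n ^ (1 + β) with hc
  have hc0 : 0 ≤ c := by positivity
  set κ := n ^ ((1 - β) / 2) with hκ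
  have hκ0 : 0 < κ := Real.rpow_pos_of_pos hn0 _
  have hcn : c * n ^ (-β) = (k : ℝ) ^ 2 * n := by
    rw [hc, mul_assoc, ← Real.rpow_add hn0, show 1 + β + -β = 1 by ring, Real.rpow_one]
  set N : ℝ := k * n with hN
  have hN0 : 0 < N := by positivity
  have hsq : ∀ r, 0 ≤ r → ∑ x, b r x ^ 2 ≤ N * C ^ 2 := fun r hr =>
    hb.sum_sq_le_of_abs_le hα hc0 hC hr
  have habs : ∀ r, 0 ≤ r → ∑ x, |b r x| ≤ N * ((1 + C ^ 2) / 2) := fun r hr =>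
    hb.sum_abs_le_of_abs_le hα hc0 hC hr
  have hsub : ∀ s : ℝ, HasDerivAt (fun s : ℝ => t - s) (-1) s := fun s => by
    simpa using (hasDerivAt_id s).const_sub t
  let M : ℝ → ℝ := fun s => 1 / N * ∑ x, b (t - s) x * r s (box x)
  let M' : ℝ → ℝ := fun s => 1 / N * ∑ x, (-(c * lap α β (m + 1) k (b (t - s)) x) * r s (box x)
    + b (t - s) x * (α * q s (box x)))
  have hbx : ∀ x s, HasDerivAt (fun s => b (t - s) x) (-(c * lap α β (m + 1) k (b (t - s)) x)) s :=
    fun x s => ((hb.hasDerivAt_apply (t - s) x).comp s (hsub s)).congr_deriv (by ring)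
  have hM : ∀ s ∈ Ico 0 t, HasDerivWithinAt M (M' s) (Ici s) s := fun s hs =>
    (HasDerivWithinAt.fun_sum fun x _ =>
      (hbx x s).hasDerivWithinAt.mul (hr' (box x) s hs)).const_mul _
  have hMc : ContinuousOn M (Icc 0 t) := by
    refine continuousOn_const.mul (continuousOn_finsetSum _ fun x _ => ?_)
    exact ContinuousOn.mul (fun s _ => (hbx x s).continuousAt.continuousWithinAt) (hr (box x))
  let D : ℝ → ℝ := fun s => dirichlet α β c (b (t - s))
  -- Explicit primitive of the bound on `M'`: the loss of `ℓ²` norm supplies the time integral of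
  -- the Dirichlet form, so no pointwise-in-time bound on it is needed.
  let E : ℝ → ℝ := fun s => α * (3 * K * (κ / 2)
    * (s + 1 / (2 * N) * (∑ x, b (t - s) x ^ 2 - ∑ x, b t x ^ 2)) + δ * s * ((1 + C ^ 2) / 2))
  have hE : ∀ s, HasDerivAt E
      (α * (3 * K * (κ / 2) * (1 + D s / N) + δ * ((1 + C ^ 2) / 2))) s := by
    intro s
    have h1 := (hb.hasDerivAt_sum_sq (t - s)).comp s (hsub s)
    have h2 := ((((hasDerivAt_id s).fun_add ((h1.sub_const (∑ x, b t x ^ 2)).const_mul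
      (1 / (2 * N)))).const_mul (3 * K * (κ / 2))).fun_add
      (((hasDerivAt_id s).const_mul δ).mul_const ((1 + C ^ 2) / 2))).const_mul α
    refine h2.congr_deriv ?_
    simp only [D]
    field_simp
  have hbound : ∀ s ∈ Ico 0 t, ‖M' s‖
      ≤ α * (3 * K * (κ / 2) * (1 + D s / N) + δ * ((1 + C ^ 2) / 2)) := by
    intro s hs
    set a := b (t - s) with ha
    have h1 : ∑ x, (-(c * lap α β (m + 1) k a x) * r s (box x) + a x * (α * q s (box x)))
        = α * ((k : ℝ) ^ 2 * (m + 1) * ∑ i, (inBoxes a (finRotate k i) 0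
            - inBoxes a i (Fin.last m)) * (r s (finRotate k i) - r s i)
          + ∑ i, ∑ j, inBoxes a i j * q s i) := by
      have h2 := sum_mul_lap α β (fun x => r s (box x)) a
      rw [sum_conductance_grad_box, ← hn] at h2
      have h3 : ∑ i, ∑ j, inBoxes a i j * q s i = ∑ x, a x * q s (box x) := by
        rw [sum_site]
        simp [inBoxes]
      have h4 : ∑ x, (-(c * lap α β (m + 1) k a x) * r s (box x) + a x * (α * q s (box x)))
          = -c * ∑ x, r s (box x) * lap α β (m + 1) k a x + α * ∑ x, a x * q s (box x) := by
        rw [Finset.mul_sum, Finset.mul_sum, ← Finset.sum_add_distrib]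
        exact Finset.sum_congr rfl fun x _ => by ring
      have hnm : n = m + 1 := by simp [hn]
      rw [h4, h3, h2, ← hnm]
      set F := ∑ i, (inBoxes a (finRotate k i) 0 - inBoxes a i (Fin.last m))
        * (r s (finRotate k i) - r s i)
      linear_combination α * F * hcn
    have h2 := abs_flux_add_le hk (inBoxes a) (r s) (q s) (hK s hs) (hδ s hs)
    have h3 := boxVariation_le hk hα β a
    have h4 : ∑ i, ∑ j, |inBoxes a i j| = ∑ x, |a x| := by
      rw [sum_site]
      rfl
    have h5 := habs (t - s) (by linarith [hs.2])
    have hnm : n = m + 1 := by simp [hn]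
    rw [h4, ← hnm] at h2
    simp only [M']
    rw [← ha, h1, Real.norm_eq_abs, abs_mul, abs_mul, abs_of_nonneg hα,
      abs_of_nonneg (by positivity : 0 ≤ 1 / N), ← hnm]
    calc 1 / N * (α * |_|) ≤ 1 / N * (α * (N * (3 * K * (κ / 2 * (1 + D s / N)))
            + δ * (N * ((1 + C ^ 2) / 2)))) := by
          gcongr
          refine h2.trans ?_
          gcongr
      _ = _ := by
          field_simp
  have hfin := image_norm_le_of_norm_deriv_right_le_deriv_boundary
    (f := fun s => M s - M 0) (hMc.sub continuousOn_const)
    (fun s hs => (hM s hs).sub_const (M 0)) (B := E) (by simp [E]) hE hbound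
    (right_mem_Icc.2 ht)
  have hE2 : E t ≤ α * (3 * K * (κ / 2) * (t + C ^ 2 / 2) + δ * t * ((1 + C ^ 2) / 2)) := by
    have h1 : 1 / (2 * N) * (∑ x, b (t - t) x ^ 2 - ∑ x, b t x ^ 2) ≤ C ^ 2 / 2 := by
      have h2 := hsq (t - t) (by simp)
      have h3 : 0 ≤ ∑ x, b t x ^ 2 := Finset.sum_nonneg fun x _ => sq_nonneg _
      calc _ ≤ 1 / (2 * N) * (N * C ^ 2) := by gcongr; linarith
        _ = C ^ 2 / 2 := by field_simp
    simp only [E]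
    gcongr
  refine le_trans (le_of_eq ?_) (hfin.trans hE2)
  simp only [M, sub_self, sub_zero, Real.norm_eq_abs]

end Mean

/-! ### Second differences and Riemann sums -/

section Calculus

/-- Two mean value inequalities, first for `f'` minus its linear part, then for the increment `f (y
+ h) - f y`, avoid any third derivative. -/
theorem abs_second_difference_sub_le {f : ℝ → ℝ} (hf : ContDiff ℝ 2 f) {u h ε : ℝ} (hh : 0 ≤ h)
    (hε : ∀ y ∈ Icc (u - h) (u + h), |iteratedDeriv 2 f y - iteratedDeriv 2 f u| ≤ ε) :
    |f (u + h) - 2 * f u + f (u - h) - h ^ 2 * iteratedDeriv 2 f u| ≤ ε * h ^ 2 := by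
  set L := iteratedDeriv 2 f u with hL
  have h2 : iteratedDeriv 2 f = deriv (deriv f) := by
    rw [iteratedDeriv_succ, iteratedDeriv_one]
  have hd : ∀ y, HasDerivAt f (deriv f y) y := fun y =>
    (hf.differentiable (by norm_num) y).hasDerivAt
  have hdd : ∀ y, HasDerivAt (deriv f) (iteratedDeriv 2 f y) y := fun y => by
    rw [h2]
    exact (((contDiff_succ_iff_deriv (n := 1)).1 hf).2.2.differentiable one_ne_zero y).hasDerivAt
  let p : ℝ → ℝ := fun y => deriv f y - L * y
  have hp : ∀ y, HasDerivAt p (iteratedDeriv 2 f y - L) y := fun y =>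
    ((hdd y).sub ((hasDerivAt_id y).const_mul L)).congr_deriv (by ring)
  have hp' : ∀ y ∈ Icc (u - h) u, |p (y + h) - p y| ≤ ε * h := by
    intro y hy
    have := (convex_Icc (u - h) (u + h)).norm_image_sub_le_of_norm_hasDerivWithin_le
      (fun z _ => (hp z).hasDerivWithinAt) hε (x := y) (y := y + h)
      ⟨hy.1, by linarith [hy.2]⟩ ⟨by linarith [hy.1], by linarith [hy.2]⟩
    simpa [abs_of_nonneg hh] using this
  let g : ℝ → ℝ := fun y => f (y + h) - f y - L * h * y
  have hg : ∀ y, HasDerivAt g (p (y + h) - p y) y := fun y => by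
    have h3 : HasDerivAt (fun y => f (y + h)) (deriv f (y + h)) y := (hd (y + h)).comp_add_const y h
    exact ((h3.sub (hd y)).sub ((hasDerivAt_id y).const_mul (L * h))).congr_deriv
      (by simp only [p]; ring)
  have := (convex_Icc (u - h) u).norm_image_sub_le_of_norm_hasDerivWithin_le
    (fun z _ => (hg z).hasDerivWithinAt) hp' (x := u - h) (y := u)
    ⟨le_rfl, by linarith⟩ ⟨by linarith, le_rfl⟩
  simp only [g, Real.norm_eq_abs, sub_sub_cancel, abs_of_nonneg hh, sub_add_cancel] at this
  convert this using 1
  · congr 1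
    ring
  · ring

theorem tendsto_average_torus {F : Torus → ℝ} (hF : Continuous F) :
    Tendsto (fun k : ℕ => 1 / (k : ℝ) * ∑ i : Fin k, F ((((i : ℕ) : ℝ) / (k : ℝ) : ℝ) : Torus))
      atTop (𝓝 (∫ u, F u)) := by
  let f : ℝ → ℝ := fun u => F (u : Torus)
  have hf : Continuous f := hF.comp (AddCircle.continuous_mk' 1)
  have hI : ∫ u, F u = ∫ u in (0 : ℝ)..1, f u := by
    simpa using (UnitAddCircle.intervalIntegral_preimage 0 F).symm
  rw [Metric.tendsto_atTop]
  intro ε hε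
  have huc := isCompact_Icc.uniformContinuousOn_of_continuous (hf.continuousOn (s := Icc 0 1))
  obtain ⟨δ, hδ, hδf⟩ := Metric.uniformContinuousOn_iff.1 huc (ε / 2) (by positivity)
  obtain ⟨K, hK⟩ := exists_nat_gt (1 / δ)
  refine ⟨K + 1, fun k hk => ?_⟩
  have hk0 : (0 : ℝ) < k := by
    have : 0 < k := by omega
    exact_mod_cast this
  have hkδ : 1 / (k : ℝ) < δ := by
    have h1 : (K : ℝ) < k := by exact_mod_cast hk
    rw [div_lt_iff₀ hk0, ← div_lt_iff₀' hδ]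
    linarith
  have hsum : ∫ u in (0 : ℝ)..1, f u
      = ∑ i ∈ Finset.range k, ∫ u in ((i : ℝ) / k)..(((i + 1 : ℕ) : ℝ) / k), f u := by
    rw [intervalIntegral.sum_integral_adjacent_intervals (a := fun i : ℕ => (i : ℝ) / k)
      fun i _ => hf.intervalIntegrable _ _]
    simp [div_self hk0.ne']
  rw [hI, hsum, Fin.sum_univ_eq_sum_range fun i : ℕ => f ((i : ℝ) / k), Finset.mul_sum,
    Real.dist_eq, ← Finset.sum_sub_distrib]
  have hterm : ∀ i ∈ Finset.range k, |1 / (k : ℝ) * f ((i : ℝ) / k)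
      - ∫ u in ((i : ℝ) / k)..(((i + 1 : ℕ) : ℝ) / k), f u| ≤ ε / 2 * (1 / k) := by
    intro i hi
    have hlen : ((i + 1 : ℕ) : ℝ) / k - (i : ℝ) / k = 1 / k := by
      push_cast
      ring
    have h1 : 1 / (k : ℝ) * f ((i : ℝ) / k)
        = ∫ _u in ((i : ℝ) / k)..(((i + 1 : ℕ) : ℝ) / k), f ((i : ℝ) / k) := by
      rw [intervalIntegral.integral_const, hlen, smul_eq_mul]
    rw [h1, ← intervalIntegral.integral_sub (continuous_const.intervalIntegrable _ _)
      (hf.intervalIntegrable _ _)]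
    have h2 := intervalIntegral.norm_integral_le_of_norm_le_const
      (a := (i : ℝ) / k) (b := ((i + 1 : ℕ) : ℝ) / k) (C := ε / 2)
      (f := fun u => f ((i : ℝ) / k) - f u) ?_
    · rwa [hlen, abs_of_nonneg (by positivity)] at h2
    · intro u hu
      rw [uIoc_of_le (by gcongr; simp)] at hu
      have hik : ((i + 1 : ℕ) : ℝ) / k ≤ 1 := by
        rw [div_le_one hk0]
        exact_mod_cast Finset.mem_range.1 hi
      have hi0 : (0 : ℝ) ≤ (i : ℝ) / k := by positivity
      rw [← dist_eq_norm]
      refine (hδf _ ⟨hi0, by linarith [hu.1, hu.2]⟩ _ ⟨by linarith [hu.1], by linarith [hu.2]⟩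
        ?_).le
      rw [Real.dist_eq, abs_sub_comm, abs_of_pos (by linarith [hu.1])]
      linarith [hu.2]
  calc |∑ i ∈ Finset.range k, (1 / (k : ℝ) * f ((i : ℝ) / k)
        - ∫ u in ((i : ℝ) / k)..(((i + 1 : ℕ) : ℝ) / k), f u)|
      ≤ ∑ i ∈ Finset.range k, ε / 2 * (1 / (k : ℝ)) :=
        (Finset.abs_sum_le_sum_abs _ _).trans (Finset.sum_le_sum hterm)
    _ = ε / 2 := by
        rw [Finset.sum_const, Finset.card_range, nsmul_eq_mul]
        field_simp
    _ < ε := by linarith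

end Calculus

/-! ### Uniform regularity of the heat solution -/

section HeatSolution

variable {α T : ℝ} {γ : Torus → ℝ} {ρ : ℝ → Torus → ℝ}

theorem IsStrongHeatSolution.exists_lipschitz (hρ : IsStrongHeatSolution α T γ ρ) :
    ∃ K, 0 ≤ K ∧ ∀ s ∈ Icc 0 T, ∀ u ∈ Icc (0 : ℝ) 2, ∀ v ∈ Icc (0 : ℝ) 2,
      |ρ s (v : Torus) - ρ s (u : Torus)| ≤ K * |v - u| := by
  obtain ⟨K, hK⟩ := (isCompact_Icc.prod isCompact_Icc).exists_bound_of_continuousOn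
    ((hρ.cont_space_deriv 1 one_le_two).mono
      (prod_mono_right (subset_univ (Icc (0 : ℝ) 2)) : Icc 0 T ×ˢ Icc (0 : ℝ) 2 ⊆ _))
  refine ⟨max K 0, le_max_right _ _, fun s hs u hu v hv => ?_⟩
  have hd : Differentiable ℝ fun v : ℝ => ρ s (v : Torus) :=
    (hρ.space_diff s hs).differentiable (by norm_num)
  refine (convex_Icc (0 : ℝ) 2).norm_image_sub_le_of_norm_deriv_le (f := fun v : ℝ => ρ s v)
    (fun x _ => hd x) (fun x hx => ?_) hu hv
  have := hK (s, x) ⟨hs, hx⟩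
  rw [iteratedDeriv_one] at this
  exact this.trans (le_max_left _ _)

theorem IsStrongHeatSolution.exists_second_difference (hρ : IsStrongHeatSolution α T γ ρ)
    {ε : ℝ} (hε : 0 < ε) :
    ∃ δ > 0, ∀ h, 0 ≤ h → h < δ → ∀ s ∈ Icc 0 T, ∀ u ∈ Icc (0 : ℝ) 1,
      |ρ s ((u + h : ℝ) : Torus) - 2 * ρ s (u : Torus) + ρ s ((u - h : ℝ) : Torus)
        - h ^ 2 * iteratedDeriv 2 (fun v : ℝ => ρ s (v : Torus)) u| ≤ ε * h ^ 2 := by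
  have huc := (isCompact_Icc.prod isCompact_Icc).uniformContinuousOn_of_continuous
    ((hρ.cont_space_deriv 2 le_rfl).mono
      (prod_mono_right (subset_univ (Icc (-1 : ℝ) 2)) : Icc 0 T ×ˢ Icc (-1 : ℝ) 2 ⊆ _))
  -- Uniform continuity on a compact set makes `δ` independent of time and position; the window
  -- `[-1, 2]` leaves room for steps `h < 1` from `[0, 1]`.
  obtain ⟨δ, hδ, hδf⟩ := Metric.uniformContinuousOn_iff.1 huc ε hε
  refine ⟨min δ 1, lt_min hδ one_pos, fun h hh0 hh s hs u hu => ?_⟩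
  have h1 := lt_min_iff.1 hh
  refine abs_second_difference_sub_le (f := fun v : ℝ => ρ s (v : Torus)) (hρ.space_diff s hs)
    hh0 fun y hy => ?_
  refine (hδf (s, y) ⟨hs, by linarith [hy.1, hu.1], by linarith [hy.2, hu.2]⟩ (s, u)
    ⟨hs, by linarith [hu.1], by linarith [hu.2]⟩ ?_).le
  rw [Prod.dist_eq, dist_self, max_eq_right dist_nonneg, Real.dist_eq]
  exact (abs_le.2 ⟨by linarith [hy.1], by linarith [hy.2]⟩).trans_lt h1.1

theorem IsStrongHeatSolution.hasDerivWithinAt (hρ : IsStrongHeatSolution α T γ ρ) {s : ℝ}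
    (hs : s ∈ Ico 0 T) (u : ℝ) :
    HasDerivWithinAt (fun s => ρ s (u : Torus))
      (α * iteratedDeriv 2 (fun v : ℝ => ρ s (v : Torus)) u) (Ici s) s := by
  have hs' := Ico_subset_Icc_self hs
  rw [← hρ.equation s hs' u]
  exact (hρ.time_diff s hs' u).hasDerivWithinAt.mono_of_mem_nhdsWithin
    (mem_of_superset (Icc_mem_nhdsGE hs.2) (Icc_subset_Icc_left hs.1))

theorem IsStrongHeatSolution.continuousOn_time (hρ : IsStrongHeatSolution α T γ ρ) (u : Torus) :
    ContinuousOn (fun s => ρ s u) (Icc 0 T) :=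
  fun t ht => (hρ.time_diff t ht u).continuousWithinAt

end HeatSolution

/-- The point `i / k` of the torus. -/
def boxPoint {k : ℕ} (i : Fin k) : Torus := ((((i : ℕ) : ℝ) / (k : ℝ) : ℝ) : Torus)

theorem boxPoint_finRotate {k : ℕ} (i : Fin k) :
    boxPoint (finRotate k i) = ((((i : ℕ) : ℝ) / k + 1 / k : ℝ) : Torus) := by
  have hk : (k : ℝ) ≠ 0 := by
    have := i.pos
    positivity
  rw [boxPoint, val_finRotate]
  rcases Nat.lt_or_ge ((i : ℕ) + 1) k with h | h
  · rw [Nat.mod_eq_of_lt h]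
    congr 1
    push_cast
    ring
  · have h1 : (i : ℕ) + 1 = k := le_antisymm i.2 h
    have h2 : ((i : ℕ) : ℝ) / k + 1 / k = 1 := by
      rw [← add_div, div_eq_one_iff_eq hk]
      exact_mod_cast h1
    rw [h1, Nat.mod_self, h2]
    simpa using (AddCircle.coe_period (1 : ℝ)).symm

theorem boxPoint_finRotate_symm {k : ℕ} (i : Fin k) :
    boxPoint ((finRotate k).symm i) = ((((i : ℕ) : ℝ) / k - 1 / k : ℝ) : Torus) := by
  have h := boxPoint_finRotate ((finRotate k).symm i)
  rw [Equiv.apply_symm_apply] at h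
  rw [AddCircle.coe_sub, ← boxPoint, h, AddCircle.coe_add, add_sub_cancel_right]
  rfl

/-! ### Quantitative estimates for the empirical measure -/

section Limit

theorem integral_averagedEmpirical {n k : ℕ} (η : Config n k) (G : Torus → ℝ) :
    ∫ u, G u ∂(averagedEmpirical η)
      = linearStat (fun x => 1 / ((k : ℝ) * n) * G (boxPoint (box x))) η := by
  have hnn : ∀ i, 0 ≤ 1 / (k : ℝ) * boxAverage η i := fun i => by
    unfold boxAverage occ
    refine mul_nonneg (by positivity) (mul_nonneg (by positivity) ?_)
    exact Finset.sum_nonneg fun j _ => by split_ifs <;> norm_num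
  rw [averagedEmpirical, integral_finsetSum_measure fun i _ =>
    (integrable_dirac (by simp)).smul_measure ENNReal.ofReal_ne_top, linearStat, sum_site]
  refine Finset.sum_congr rfl fun i _ => ?_
  rw [integral_smul_measure, integral_dirac, ENNReal.toReal_ofReal (hnn i)]
  simp only [box_finProdFinEquiv, boxAverage, boxPoint, smul_eq_mul, ← Finset.mul_sum]
  ring

theorem integral_abs_le_sqrt {E : Type*} [Finite E] [MeasurableSpace E]
    [DiscreteMeasurableSpace E] (ν : Measure E) [IsProbabilityMeasure ν] (f : E → ℝ) :
    ∫ e, |f e| ∂ν ≤ √(∫ e, f e ^ 2 ∂ν) := by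
  have h1 := variance_eq_sub (μ := ν) (X := fun e => |f e|) .of_discrete
  have h2 := variance_nonneg (fun e => |f e|) ν
  simp only [Pi.pow_apply, sq_abs] at h1
  exact Real.le_sqrt_of_sq_le (by linarith)

/-- The discrepancy between a macroscopic observable and a deterministic value is controlled by
the expectation of the observable, computed with the one-particle flow. -/
theorem integral_abs_sub_le {n k : ℕ} (hn : 0 < n) (hk : 0 < k) {α β c C : ℝ} (hα : 0 ≤ α)
    (hc : 0 ≤ c) {Ω : Type*} [MeasurableSpace Ω] {P : Measure Ω} [IsProbabilityMeasure P]
    {γ : Torus → unitInterval} {X : ℝ≥0 → Ω → Config n k}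
    (hX : IsMarkovProcess P (c • generator α β n k) (initialMeasure γ n k) X)
    {G : Torus → ℝ} (hC : ∀ u, |G u| ≤ C) {b : ℝ → Site n k → ℝ} (hb : IsFlow α β c n k b)
    (hb0 : b 0 = fun x => G (boxPoint (box x))) (t : ℝ≥0) (I : ℝ) :
    ∫ w, |(∫ u, G u ∂(averagedEmpirical (X t w))) - I| ∂P
      ≤ √(3 / 4 * C ^ 2 / (k * n) + (1 / ((k : ℝ) * n)
        * ∑ x, b t x * γ ((((x : ℕ) : ℝ) / ((k : ℝ) * (n : ℝ)) : ℝ) : Torus) - I) ^ 2) := by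
  have hk' : (0 : ℝ) < k := by exact_mod_cast hk
  have hn' : (0 : ℝ) < n := by exact_mod_cast hn
  set N : ℝ := k * n with hN
  have hN0 : 0 < N := by positivity
  let a : ℝ → Site n k → ℝ := fun r => (1 / N) • b r
  have ha : IsFlow α β c n k a := hb.const_mul _
  have hsq : ∀ r, 0 ≤ r → ∑ x, a r x ^ 2 ≤ C ^ 2 / N := by
    intro r hr
    have h1 := hb.sum_sq_le_of_abs_le hα hc (C := C) (fun x => by rw [hb0]; exact hC _) hr
    calc ∑ x, a r x ^ 2 = (1 / N) ^ 2 * ∑ x, b r x ^ 2 := by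
          rw [Finset.mul_sum]
          exact Finset.sum_congr rfl fun x _ => by
            simp only [a, Pi.smul_apply, smul_eq_mul, mul_pow]
      _ ≤ (1 / N) ^ 2 * (N * C ^ 2) := by gcongr
      _ = C ^ 2 / N := by field_simp
  have hG : ∀ w, ∫ u, G u ∂(averagedEmpirical (X t w)) = linearStat (a 0) (X t w) := fun w => by
    rw [integral_averagedEmpirical]
    congr 1
    funext x
    simp [a, hb0, hN]
  have hP : IsProbabilityMeasure (P.map (X t)) :=
    Measure.isProbabilityMeasure_map (hX.measurable t).aemeasurable
  have h1 := integral_abs_le_sqrt (P.map (X t)) fun η => linearStat (a 0) η - I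
  rw [integral_map (hX.measurable t).aemeasurable
      (measurable_of_countable _).aestronglyMeasurable,
    integral_map (hX.measurable t).aemeasurable
      (measurable_of_countable _).aestronglyMeasurable] at h1
  simp only [hG]
  refine h1.trans (Real.sqrt_le_sqrt ?_)
  have h2 := integral_sq_linearStat_le hX hα hc ha I t
  have h3 := integral_sq_linearStat_initialMeasure_le γ (a t) I
  have h4 : ∑ x, a t x * γ ((((x : ℕ) : ℝ) / ((k : ℝ) * (n : ℝ)) : ℝ) : Torus)
      = 1 / N * ∑ x, b t x * γ ((((x : ℕ) : ℝ) / ((k : ℝ) * (n : ℝ)) : ℝ) : Torus) := by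
    rw [Finset.mul_sum]
    exact Finset.sum_congr rfl fun x _ => by
      simp only [a, Pi.smul_apply, smul_eq_mul, mul_assoc]
  rw [h4] at h3
  have h5 := hsq 0 le_rfl
  have h6 := hsq t t.2
  -- The share `1/4` is the initial variance, the share `1/2` the noise of the dynamics.
  have h7 : 3 / 4 * C ^ 2 / N = 1 / 4 * (C ^ 2 / N) + 1 / 2 * (C ^ 2 / N) := by ring
  linarith

theorem abs_sub_boxPoint_le {n k : ℕ} {f : Torus → ℝ} {K : ℝ} (hK0 : 0 ≤ K)
    (hK : ∀ u ∈ Icc (0 : ℝ) 2, ∀ v ∈ Icc (0 : ℝ) 2,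
      |f (v : Torus) - f (u : Torus)| ≤ K * |v - u|) (x : Site n k) :
    |f ((((x : ℕ) : ℝ) / ((k : ℝ) * (n : ℝ)) : ℝ) : Torus) - f (boxPoint (box x))| ≤ K / k := by
  obtain ⟨⟨i, j⟩, rfl⟩ := finProdFinEquiv.surjective x
  have hk : (0 : ℝ) < k := by exact_mod_cast i.pos
  have hn : (0 : ℝ) < n := by exact_mod_cast j.pos
  have hi : (i : ℝ) / k + 1 / k ≤ 1 := by
    rw [← add_div, div_le_one hk]
    exact_mod_cast i.2
  have hi0 : 0 ≤ (i : ℝ) / k := by positivity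
  have hj : (j : ℝ) / (k * n) ≤ 1 / k := by
    rw [div_le_div_iff₀ (by positivity) hk]
    have : (j : ℝ) ≤ n := by exact_mod_cast j.2.le
    nlinarith
  have hj0 : 0 ≤ (j : ℝ) / (k * n) := by positivity
  have hx : ((finProdFinEquiv (i, j) : Fin (k * n)) : ℕ) / ((k : ℝ) * n)
      = (i : ℝ) / k + (j : ℝ) / (k * n) := by
    rw [finProdFinEquiv_apply_val]
    push_cast
    field_simp
    ring
  rw [box_finProdFinEquiv, boxPoint, hx]
  have h0 : 0 ≤ 1 / (k : ℝ) := by positivity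
  refine (hK _ ⟨hi0, by linarith⟩ _ ⟨by linarith, by linarith⟩).trans ?_
  rw [add_sub_cancel_left, abs_of_nonneg hj0, div_eq_mul_one_div K]
  exact mul_le_mul_of_nonneg_left hj hK0

theorem torusContDiff_continuous {m : WithTop ℕ∞} {g : Torus → ℝ} (hg : TorusContDiff m g) :
    Continuous g :=
  (QuotientAddGroup.isQuotientMap_mk _).continuous_iff.2 hg.continuous

/-- The difference between the expected observable and its Riemann sum along the heat flow. -/
theorem abs_expectation_sub_le {n k : ℕ} (hn : 0 < n) (hk : 0 < k) {α β C : ℝ} (hα : 0 < α)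
    {γ : Torus → unitInterval} {T : ℝ} {ρ : ℝ → Torus → ℝ}
    (hρ : IsStrongHeatSolution α T (fun u => (γ u : ℝ)) ρ)
    {K : ℝ} (hK0 : 0 ≤ K) (hK : ∀ s ∈ Icc 0 T, ∀ u ∈ Icc (0 : ℝ) 2, ∀ v ∈ Icc (0 : ℝ) 2,
      |ρ s (v : Torus) - ρ s (u : Torus)| ≤ K * |v - u|)
    {δ : ℝ} (hδ0 : 0 ≤ δ) (hδ : ∀ s ∈ Icc 0 T, ∀ u ∈ Icc (0 : ℝ) 1,
      |ρ s ((u + 1 / k : ℝ) : Torus) - 2 * ρ s (u : Torus) + ρ s ((u - 1 / k : ℝ) : Torus)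
        - (1 / (k : ℝ)) ^ 2 * iteratedDeriv 2 (fun v : ℝ => ρ s (v : Torus)) u|
        ≤ δ * (1 / (k : ℝ)) ^ 2)
    {G : Torus → ℝ} (hC : ∀ u, |G u| ≤ C) {b : ℝ → Site n k → ℝ}
    (hb : IsFlow α β ((k : ℝ) ^ 2 * (n : ℝ) ^ (1 + β)) n k b)
    (hb0 : b 0 = fun x => G (boxPoint (box x))) {t : ℝ} (ht0 : 0 ≤ t) (htT : t ≤ T) :
    |1 / ((k : ℝ) * n) * ∑ x, b t x * γ ((((x : ℕ) : ℝ) / ((k : ℝ) * (n : ℝ)) : ℝ) : Torus)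
        - 1 / (k : ℝ) * ∑ i : Fin k, G (boxPoint i) * ρ t (boxPoint i)|
      ≤ (1 + C ^ 2) / 2 * (K / k) + α * (3 * K * ((n : ℝ) ^ ((1 - β) / 2) / 2) * (t + C ^ 2 / 2)
        + δ * t * ((1 + C ^ 2) / 2)) := by
  obtain ⟨m, rfl⟩ : ∃ m, n = m + 1 := ⟨n - 1, by omega⟩
  have hk' : (0 : ℝ) < k := by exact_mod_cast hk
  set n : ℝ := ((m + 1 : ℕ) : ℝ) with hn'
  have hn0 : 0 < n := by simp only [hn']; positivity
  set N : ℝ := k * n with hN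
  have hN0 : 0 < N := by positivity
  have hc : 0 ≤ (k : ℝ) ^ 2 * n ^ (1 + β) := by positivity
  have hC0 : ∀ x, |b 0 x| ≤ C := fun x => by
    rw [hb0]
    exact hC _
  have hpt : ∀ i : Fin k, (i : ℝ) / k + 1 / k ≤ 1 := fun i => by
    rw [← add_div, div_le_one hk']
    exact_mod_cast i.2
  have hpt0 : ∀ i : Fin k, 0 ≤ (i : ℝ) / k := fun i => by positivity
  have hk1 : 0 < 1 / (k : ℝ) := by positivity
  have hmain := hb.abs_sum_sub_sum_le hk hα.le hC0 ht0
    (r := fun s i => ρ s (boxPoint i))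
    (q := fun s i => iteratedDeriv 2 (fun v : ℝ => ρ s (v : Torus)) ((i : ℝ) / k))
    (K := K) (δ := δ)
    (fun i => (hρ.continuousOn_time _).mono (Icc_subset_Icc_right htT))
    (fun i s hs => hρ.hasDerivWithinAt ⟨hs.1, hs.2.trans_le htT⟩ _)
    (fun s hs i => by
      rw [boxPoint_finRotate]
      refine (hK s ⟨hs.1, hs.2.le.trans htT⟩ ((i : ℝ) / k) ⟨hpt0 i, by linarith [hpt i]⟩ _
        ⟨by linarith [hpt0 i], by linarith [hpt i]⟩).trans_eq ?_
      rw [add_sub_cancel_left, abs_of_pos hk1]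
      ring)
    (fun s hs i => by
      have h1 := hδ s ⟨hs.1, hs.2.le.trans htT⟩ ((i : ℝ) / k) ⟨hpt0 i, by linarith [hpt i]⟩
      rw [boxPoint_finRotate, boxPoint_finRotate_symm, boxPoint]
      set A := ρ s (((i : ℝ) / k + 1 / k : ℝ) : Torus) - 2 * ρ s (((i : ℝ) / k : ℝ) : Torus)
        + ρ s (((i : ℝ) / k - 1 / k : ℝ) : Torus)
      set L := iteratedDeriv 2 (fun v : ℝ => ρ s (v : Torus)) ((i : ℝ) / k)
      have h2 : (k : ℝ) ^ 2 * A - L = (k : ℝ) ^ 2 * (A - (1 / (k : ℝ)) ^ 2 * L) := by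
        field_simp
      rw [h2, abs_mul, abs_of_nonneg (by positivity)]
      calc (k : ℝ) ^ 2 * |A - (1 / (k : ℝ)) ^ 2 * L| ≤ (k : ℝ) ^ 2 * (δ * (1 / (k : ℝ)) ^ 2) := by
            gcongr
        _ = δ := by field_simp)
    hK0 hδ0
  rw [← hn', ← hN] at hmain
  have hR : 1 / N * ∑ x, b 0 x * ρ t (boxPoint (box x))
      = 1 / (k : ℝ) * ∑ i : Fin k, G (boxPoint i) * ρ t (boxPoint i) := by
    rw [hb0, sum_site]
    simp only [box_finProdFinEquiv, Finset.sum_const, Finset.card_univ, Fintype.card_fin,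
      nsmul_eq_mul, ← Finset.mul_sum]
    rw [← hn', hN]
    field_simp
  have hγ : |1 / N * ∑ x, b t x * γ ((((x : ℕ) : ℝ) / ((k : ℝ) * n) : ℝ) : Torus)
      - 1 / N * ∑ x, b t x * ρ 0 (boxPoint (box x))| ≤ (1 + C ^ 2) / 2 * (K / k) := by
    have h1 := hb.sum_abs_le_of_abs_le hα.le hc hC0 ht0
    rw [← hn', ← hN] at h1
    rw [← mul_sub, ← Finset.sum_sub_distrib, abs_mul, abs_of_nonneg (by positivity)]
    calc 1 / N * |∑ x, (b t x * γ ((((x : ℕ) : ℝ) / ((k : ℝ) * n) : ℝ) : Torus)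
          - b t x * ρ 0 (boxPoint (box x)))|
        ≤ 1 / N * ∑ x, |b t x| * (K / k) := by
          gcongr
          refine (Finset.abs_sum_le_sum_abs _ _).trans (Finset.sum_le_sum fun x _ => ?_)
          rw [← mul_sub, abs_mul, ← hρ.initial]
          gcongr
          exact abs_sub_boxPoint_le hK0 (hK 0 ⟨le_rfl, ht0.trans htT⟩) x
      _ = 1 / N * (∑ x, |b t x|) * (K / k) := by rw [← Finset.sum_mul, mul_assoc]
      _ ≤ 1 / N * (N * ((1 + C ^ 2) / 2)) * (K / k) := by gcongr
      _ = (1 + C ^ 2) / 2 * (K / k) := by field_simp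
  rw [← hR]
  rw [abs_sub_comm] at hmain
  exact (abs_sub_le _ _ _).trans (add_le_add hγ hmain)

end Limit

end SlowBondExclusion

end

/-! ### Passage to the limit -/

theorem theorem2p4
    (α β : ℝ) (hα : 0 < α) (hβ : 1 < β)
    (k : ℕ → ℕ) (hk : Tendsto k atTop atTop)
    (γ : SlowBondExclusion.Torus → unitInterval)
    (hγ : SlowBondExclusion.TorusContDiff ∞ (fun u => (γ u : ℝ)))
    (ε₀ : ℝ) (hε₀ : ε₀ ∈ Ioo (0 : ℝ) (1 / 2))
    (hγε : ∀ u, ε₀ < (γ u : ℝ) ∧ (γ u : ℝ) < 1 - ε₀)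
    (T : ℝ) (hT : 0 < T)
    (ρ : ℝ → SlowBondExclusion.Torus → ℝ)
    (hρ : SlowBondExclusion.IsStrongHeatSolution α T (fun u => (γ u : ℝ)) ρ)
    {Ω : ℕ → Type*} [∀ n, MeasurableSpace (Ω n)]
    (P : ∀ n, Measure (Ω n)) [∀ n, IsProbabilityMeasure (P n)]
    (η : ∀ n, ℝ≥0 → Ω n → SlowBondExclusion.Config n (k n))
    (hη : ∀ n, SlowBondExclusion.IsMarkovProcess (P n)
      (((k n : ℝ) ^ 2 * (n : ℝ) ^ (1 + β)) • SlowBondExclusion.generator α β n (k n))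
      (SlowBondExclusion.initialMeasure γ n (k n)) (η n))
    (t : ℝ≥0) (ht : (t : ℝ) ≤ T)
    (G : SlowBondExclusion.Torus → ℝ) (hG : SlowBondExclusion.TorusContDiff 2 G) :
    Tendsto
      (fun n : ℕ => ∫ w, |(∫ u, G u ∂(SlowBondExclusion.averagedEmpirical (η n t w)))
        - ∫ u, G u * ρ (t : ℝ) u| ∂(P n))
      atTop (𝓝 0) := by
  have hGc : Continuous G := SlowBondExclusion.torusContDiff_continuous hG
  have hρc : Continuous (ρ t) :=
    SlowBondExclusion.torusContDiff_continuous (hρ.space_diff t ⟨t.coe_nonneg, ht⟩)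
  obtain ⟨C, hC⟩ := isCompact_univ.exists_bound_of_continuousOn hGc.continuousOn
  replace hC : ∀ u, |G u| ≤ C := fun u => hC u (mem_univ u)
  obtain ⟨K, hK0, hK⟩ := hρ.exists_lipschitz
  choose b hb hb0 using fun n : ℕ => SlowBondExclusion.exists_isFlow (n := n) (k := k n) α β
    ((k n : ℝ) ^ 2 * (n : ℝ) ^ (1 + β)) fun x => G (SlowBondExclusion.boxPoint
      (SlowBondExclusion.box x))
  have hk0 : ∀ᶠ n in atTop, 0 < k n := hk.eventually_gt_atTop 0
  have hkr : Tendsto (fun n => (k n : ℝ)) atTop atTop := tendsto_natCast_atTop_atTop.comp hk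
  have hnr : Tendsto (fun n : ℕ => (n : ℝ)) atTop atTop := tendsto_natCast_atTop_atTop
  set I := ∫ u, G u * ρ t u with hI
  let e : ℕ → ℝ := fun n => 1 / ((k n : ℝ) * n) * ∑ x : SlowBondExclusion.Site n (k n),
    b n t x * γ ((((x : ℕ) : ℝ) / ((k n : ℝ) * (n : ℝ)) : ℝ) : SlowBondExclusion.Torus)
  let R : ℕ → ℝ := fun n => 1 / (k n : ℝ) * ∑ i : Fin (k n),
    G (SlowBondExclusion.boxPoint i) * ρ t (SlowBondExclusion.boxPoint i)
  have hR : Tendsto R atTop (𝓝 I) :=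
    (SlowBondExclusion.tendsto_average_torus (hGc.mul hρc)).comp hk
  have heR : Tendsto (fun n => e n - R n) atTop (𝓝 0) := by
    have hdet : Tendsto (fun n : ℕ => (1 + C ^ 2) / 2 * (K / k n)
        + α * (3 * K * ((n : ℝ) ^ ((1 - β) / 2) / 2) * (t + C ^ 2 / 2))) atTop (𝓝 0) := by
      have h1 : Tendsto (fun n : ℕ => K / k n) atTop (𝓝 0) := hkr.const_div_atTop K
      have h2 : Tendsto (fun n : ℕ => (n : ℝ) ^ ((1 - β) / 2)) atTop (𝓝 0) := by
        have h3 := (tendsto_rpow_neg_atTop (y := (β - 1) / 2) (by linarith)).comp hnr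
        rwa [show -((β - 1) / 2) = (1 - β) / 2 by ring] at h3
      have h4 := (h1.const_mul ((1 + C ^ 2) / 2)).add
        (((((h2.div_const 2).const_mul (3 * K)).mul_const ((t : ℝ) + C ^ 2 / 2))).const_mul α)
      simpa using h4
    rw [Metric.tendsto_nhds]
    intro ε hε
    set A := α * (t * ((1 + C ^ 2) / 2)) with hA
    have hA0 : 0 ≤ A := by positivity
    -- The second-difference tolerance enters the bound as `A * δ`; the `+ 1` covers `A = 0`, which
    -- occurs at `t = 0`.
    set δ := ε / (2 * (A + 1)) with hδ
    have hδ0 : 0 < δ := by positivity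
    obtain ⟨d, hd, hdiff⟩ := hρ.exists_second_difference hδ0
    have hsmall : ∀ᶠ n in atTop, 1 / (k n : ℝ) < d :=
      (hkr.const_div_atTop 1).eventually_lt_const hd
    filter_upwards [hk0, eventually_gt_atTop 0, hsmall,
      hdet.eventually_lt_const (show 0 < ε / 2 by positivity)] with n hkn hn hsn hdn
    have h1 := SlowBondExclusion.abs_expectation_sub_le hn hkn hα hρ hK0 hK hδ0.le
      (hdiff _ (by positivity) hsn) hC (hb n) (hb0 n) t.coe_nonneg ht
    rw [Real.dist_eq, sub_zero]
    have h2 : A * δ ≤ ε / 2 := by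
      rw [hδ, mul_div_assoc', div_le_div_iff₀ (by positivity) two_pos]
      nlinarith
    refine h1.trans_lt ?_
    calc _ = (1 + C ^ 2) / 2 * (K / k n)
        + α * (3 * K * ((n : ℝ) ^ ((1 - β) / 2) / 2) * (t + C ^ 2 / 2)) + A * δ := by
          rw [hA]
          ring
      _ < ε := by linarith
  have heI : Tendsto (fun n => e n - I) atTop (𝓝 0) := by
    have h1 := (heR.add hR).sub_const I
    simpa using h1
  have hN : Tendsto (fun n : ℕ => 3 / 4 * C ^ 2 / ((k n : ℝ) * n)) atTop (𝓝 0) :=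
    (hkr.atTop_mul_atTop₀ hnr).const_div_atTop _
  have hbound : Tendsto (fun n : ℕ => √(3 / 4 * C ^ 2 / ((k n : ℝ) * n) + (e n - I) ^ 2))
      atTop (𝓝 0) := by
    simpa using (hN.add (heI.pow 2)).sqrt
  refine squeeze_zero' (Eventually.of_forall fun n => integral_nonneg fun w => abs_nonneg _)
    ?_ hbound
  filter_upwards [hk0, eventually_gt_atTop 0] with n hkn hn
  exact SlowBondExclusion.integral_abs_sub_le hn hkn hα.le (by positivity) (hη n) hC (hb n)
    (hb0 n) t I
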